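/- Let $0<q<1$, write $(a;p)_n=\prod_{j=0}^{n-1}(1-ap^j)$ and $(a;p)_\infty=\prod_{j\ge 0}(1-ap^j)$. Let $\theta,\nu,\omega\in\mathbb{C}$ with $0<|\omega|<1$ and $q^{\nu+k}\neq 1$ for all integers $k\ge 0$, and put $x=\cos\theta$. Define the basic exponential function $\mathcal{E}_q(x;i\omega)=C_q(x;\omega)+i\,S_q(x;\omega)$, where $$C_q(x;\omega)=\frac{(-\omega^2;q^2)_\infty}{(-q\omega^2;q^2)_\infty}\sum_{j=0}^\infty\frac{(-qe^{2i\theta};q^2)_j(-qe^{-2i\theta};q^2)_j}{(q;q^2)_j(q^2;q^2)_j}(-\omega^2)^j,$$ $$S_q(x;\omega)=\frac{(-\omega^2;q^2)_\infty}{(-q\omega^2;q^2)_\infty}\,\frac{2q^{1/4}\omega}{1-q}\cos\theta\sum_{j=0}^\infty\frac{(-q^2e^{2i\theta};q^2)_j(-q^2e^{-2i\theta};q^2)_j}{(q^3;q^2)_j(q^2;q^2)_j}(-\omega^2)^j,$$ Jackson's second $q$-Bessel function $$J^{(2)}_\mu(z;q)=\frac{(q^{\mu+1};q)_\infty}{(q;q)_\infty}\sum_{n=0}^\infty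 q^{(\mu+n)n}\frac{(-1)^n(z/2)^{\mu+2n}}{(q;q)_n(q^{\mu+1};q)_n},$$ and the continuous $q$-ultraspherical polynomials $$C_m(\cos\theta;\beta|q)=\sum_{k=0}^m\frac{(\beta;q)_k(\beta;q)_{m-k}}{(q;q)_k(q;q)_{m-k}}e^{i(m-2k)\theta}.$$ Complex powers are principal. Then the series below converges absolutely and $$\mathcal{E}_q(x;i\omega)=\frac{(q;q)_\infty\,\omega^{-\nu}}{(q^\nu;q)_\infty(-q\omega^2;q^2)_\infty}\sum_{m=0}^\infty i^m(1-q^{\nu+m})\,q^{m^2/4}\,J^{(2)}_{\nu+m}(2\omega;q)\,C_m(x;q^\nu|q).$$ -/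

import Mathlib

namespace IsmailZhang

noncomputable section

/-- The finite `q`-shifted factorial `(a; q)_n = ∏_{j=0}^{n-1} (1 - a q^j)`. -/
def qPoch (a q : ℂ) (n : ℕ) : ℂ :=
  ∏ j ∈ Finset.range n, (1 - a * q ^ j)

/-- The infinite `q`-shifted factorial `(a; q)_∞ = ∏_{j=0}^∞ (1 - a q^j)`, convergent for
`|q| < 1` (see `multipliable_qPochInf`). -/
def qPochInf (a q : ℂ) : ℂ :=
  ∏' j : ℕ, (1 - a * q ^ j)

theorem multipliable_qPochInf (a q : ℂ) (hq : ‖q‖ < 1) :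
    Multipliable fun j : ℕ => (1 - a * q ^ j) := by
  have h : Summable fun j : ℕ => ‖-(a * q ^ j)‖ := by
    simpa [norm_mul, norm_pow] using
      (summable_geometric_of_lt_one (norm_nonneg q) hq).mul_left ‖a‖
  simpa [sub_eq_add_neg] using multipliable_one_add_of_summable h

/-- The basic cosine function `C_q(cos θ; ω)`, for `|ω| < 1`. -/
def basicCos (q θ ω : ℂ) : ℂ :=
  qPochInf (-ω ^ 2) (q ^ 2) / qPochInf (-q * ω ^ 2) (q ^ 2) *
    ∑' j : ℕ,
      qPoch (-q * Complex.exp (2 * Complex.I * θ)) (q ^ 2) j *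
        qPoch (-q * Complex.exp (-2 * Complex.I * θ)) (q ^ 2) j /
        (qPoch q (q ^ 2) j * qPoch (q ^ 2) (q ^ 2) j) * (-ω ^ 2) ^ j

/-- The basic sine function `S_q(cos θ; ω)`, for `|ω| < 1`. -/
def basicSin (q θ ω : ℂ) : ℂ :=
  qPochInf (-ω ^ 2) (q ^ 2) / qPochInf (-q * ω ^ 2) (q ^ 2) *
    (2 * q ^ (1 / 4 : ℂ) * ω / (1 - q)) * Complex.cos θ *
    ∑' j : ℕ,
      qPoch (-q ^ 2 * Complex.exp (2 * Complex.I * θ)) (q ^ 2) j *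
        qPoch (-q ^ 2 * Complex.exp (-2 * Complex.I * θ)) (q ^ 2) j /
        (qPoch (q ^ 3) (q ^ 2) j * qPoch (q ^ 2) (q ^ 2) j) * (-ω ^ 2) ^ j

/-- The basic exponential function `𝓔_q(cos θ; iω) = C_q(cos θ; ω) + i S_q(cos θ; ω)`,
as a function of `θ` and `ω`, for `|ω| < 1`. -/
def basicExp (q θ ω : ℂ) : ℂ :=
  basicCos q θ ω + Complex.I * basicSin q θ ω

/-- Jackson's second `q`-Bessel function `J_ν^{(2)}(z; q)`, with principal powers. -/
def jacksonBessel2 (q ν z : ℂ) : ℂ :=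
  qPochInf (q ^ (ν + 1)) q / qPochInf q q *
    ∑' n : ℕ,
      q ^ ((ν + n) * n) * ((-1) ^ n * (z / 2) ^ (ν + 2 * n)) /
        (qPoch q q n * qPoch (q ^ (ν + 1)) q n)

/-- The continuous `q`-ultraspherical polynomial `C_m(cos θ; β | q)`, as a function of `θ`. -/
def qUltraspherical (q β : ℂ) (m : ℕ) (θ : ℂ) : ℂ :=
  ∑ k ∈ Finset.range (m + 1),
    qPoch β q k * qPoch β q (m - k) / (qPoch q q k * qPoch q q (m - k)) *
      Complex.exp (Complex.I * ((m : ℂ) - 2 * (k : ℂ)) * θ)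

/-- The `m`-th term `i^m (1 - q^{ν+m}) q^{m²/4} J_{ν+m}^{(2)}(2ω; q) C_m(cos θ; q^ν | q)`. -/
def ismailZhangTerm (q ν θ ω : ℂ) (m : ℕ) : ℂ :=
  Complex.I ^ m * (1 - q ^ (ν + m)) * q ^ ((m : ℂ) ^ 2 / 4) *
    jacksonBessel2 q (ν + m) (2 * ω) * qUltraspherical q (q ^ ν) m θ

end

end IsmailZhang

/-! ### Finite and infinite `q`-shifted factorials: limits and bounds. -/

namespace IsmailZhang

open Filter Topology

/-! Both sides, multiplied by `(-qω²; q²)_∞`, equal `∑_N i^N q^{N²/4} ω^N h_N`, where `h_N = H_N(x |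
q)/(q; q)_N` is the normalized continuous `q`-Hermite polynomial.

Here `h_N` is defined as `connSum`, its connection expansion in the `C_m(x; β | q)` with `β = q^ν`.
Comparing coefficients in this expansion, the ultraspherical three term recurrence gives the Hermite
one (`connSum_recurrence`), so no values of `H_N` are needed.

For the left side, eliminating odd neighbours gives a second order recurrence within each parity
class of `N`. Multiplying the even or odd series, in `u = -ω²`, by Euler's `1/(u; q²)_∞ = ∑ u^k/(q²;
q²)_k` lowers the order to one. The new coefficients are therefore quotients of shifted factorials,
namely those of `C_q` and `S_q` (`euler_cauchyProduct_recurrence`, `qPochInf_mul_tsum_eq`).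

For the right side, insert the expansion of `h_N`, put `N = m + 2n` and sum over `n` first. Since
`(m + 2n)²/4 = m²/4 + mn + n²`, the inner sum is the series of `J^{(2)}_{ν+m}(2ω; q)`
(`mul_ismailZhangTerm`). The factors `q^{m²/4}` and `q^{n²}` make the double series absolutely
convergent. -/

theorem qPoch_zero (a q : ℂ) : qPoch a q 0 = 1 := by simp [qPoch]

theorem qPoch_succ (a q : ℂ) (n : ℕ) :
    qPoch a q (n + 1) = qPoch a q n * (1 - a * q ^ n) := by
  simp [qPoch, Finset.prod_range_succ]

theorem qPoch_add (a q : ℂ) (m n : ℕ) :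
    qPoch a q (m + n) = qPoch a q m * qPoch (a * q ^ m) q n := by
  simp [qPoch, Finset.prod_range_add, pow_add, mul_assoc]

theorem qPoch_succ' (a q : ℂ) (n : ℕ) :
    qPoch a q (n + 1) = (1 - a) * qPoch (a * q) q n := by
  rw [add_comm, qPoch_add]
  simp [qPoch]

theorem qPoch_ne_zero {a q : ℂ} (h : ∀ k : ℕ, 1 - a * q ^ k ≠ 0) (n : ℕ) : qPoch a q n ≠ 0 :=
  Finset.prod_ne_zero_iff.mpr fun k _ => h k

theorem qPochInf_eq_mul (a : ℂ) {q : ℂ} (hq : ‖q‖ < 1) (n : ℕ) :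
    qPochInf a q = qPoch a q n * qPochInf (a * q ^ n) q := by
  have h := Multipliable.prod_mul_tprod_nat_mul' (f := fun j : ℕ => 1 - a * q ^ j) (k := n)
    (by simpa [pow_add, mul_assoc, mul_comm, mul_left_comm] using
      multipliable_qPochInf (a * q ^ n) q hq)
  rw [qPochInf, ← h, qPoch, qPochInf]
  congr 2
  ext j
  ring

theorem tendsto_qPoch (a : ℂ) {q : ℂ} (hq : ‖q‖ < 1) :
    Tendsto (qPoch a q) atTop (𝓝 (qPochInf a q)) :=
  (multipliable_qPochInf a q hq).tendsto_prod_tprod_nat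

theorem qPochInf_ne_zero {a q : ℂ} (hq : ‖q‖ < 1) (h : ∀ k : ℕ, 1 - a * q ^ k ≠ 0) :
    qPochInf a q ≠ 0 := by
  have hs : Summable fun j : ℕ => ‖-(a * q ^ j)‖ := by
    simpa [norm_mul, norm_pow] using
      (summable_geometric_of_lt_one (norm_nonneg q) hq).mul_left ‖a‖
  have := tprod_one_add_ne_zero_of_summable (f := fun j : ℕ => -(a * q ^ j))
    (fun i => by simpa [sub_eq_add_neg] using h i) hs
  simpa [qPochInf, sub_eq_add_neg] using this

theorem exists_norm_qPoch_le (a : ℂ) {q : ℂ} (hq : ‖q‖ < 1) :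
    ∃ M : ℝ, 0 < M ∧ ∀ n, ‖qPoch a q n‖ ≤ M := by
  obtain ⟨M, hM⟩ := (tendsto_qPoch a hq).norm.bddAbove_range
  refine ⟨max M 1, by positivity, fun n => (hM ⟨n, rfl⟩).trans (le_max_left _ _)⟩

theorem exists_norm_qPoch_inv_le {a q : ℂ} (hq : ‖q‖ < 1) (h : ∀ k : ℕ, 1 - a * q ^ k ≠ 0) :
    ∃ M : ℝ, 0 < M ∧ ∀ n, ‖(qPoch a q n)⁻¹‖ ≤ M := by
  obtain ⟨M, hM⟩ := ((tendsto_qPoch a hq).inv₀ (qPochInf_ne_zero hq h)).norm.bddAbove_range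
  refine ⟨max M 1, by positivity, fun n => (hM ⟨n, rfl⟩).trans (le_max_left _ _)⟩

theorem one_sub_mul_pow_ne_zero {a q : ℂ} (ha : ‖a‖ < 1) (hq : ‖q‖ < 1) (k : ℕ) :
    1 - a * q ^ k ≠ 0 := by
  intro h
  have h1 : ‖a * q ^ k‖ = 1 := by rw [← sub_eq_zero.mp h, norm_one]
  have h2 : ‖q‖ ^ k ≤ 1 := pow_le_one₀ (norm_nonneg _) hq.le
  rw [norm_mul, norm_pow] at h1
  nlinarith [norm_nonneg a, norm_nonneg q]

theorem one_sub_pow_succ_ne_zero {q : ℂ} (hq : ‖q‖ < 1) (k : ℕ) : 1 - q ^ (k + 1) ≠ 0 := by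
  simpa [pow_succ'] using one_sub_mul_pow_ne_zero hq hq k

/-! ### Euler's series for `1/(u; p)_∞`. -/

theorem summable_eulerSeries {p u : ℂ} (hp : ‖p‖ < 1) (hu : ‖u‖ < 1) :
    Summable fun k : ℕ => (qPoch p p k)⁻¹ * u ^ k := by
  obtain ⟨M, -, hM⟩ := exists_norm_qPoch_inv_le hp (one_sub_mul_pow_ne_zero hp hp)
  refine Summable.of_norm_bounded
    ((summable_geometric_of_lt_one (norm_nonneg u) hu).mul_left M) fun k => ?_
  rw [norm_mul, norm_pow]
  exact mul_le_mul_of_nonneg_right (hM k) (by positivity)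

/-- The functional equation of Euler's series `∑ u^k / (p; p)_k`. -/
theorem eulerSeries_mul {p u : ℂ} (hp : ‖p‖ < 1) (hu : ‖u‖ < 1) :
    (1 - u) * ∑' k : ℕ, (qPoch p p k)⁻¹ * u ^ k = ∑' k : ℕ, (qPoch p p k)⁻¹ * (u * p) ^ k := by
  have hup : ‖u * p‖ < 1 := by
    rw [norm_mul]; nlinarith [norm_nonneg u, norm_nonneg p]
  have h1 := summable_eulerSeries hp hu
  have h2 := summable_eulerSeries hp hup
  rw [sub_mul, one_mul, sub_eq_iff_eq_add, ← sub_eq_iff_eq_add', ← h1.tsum_sub h2,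
    (h1.sub h2).tsum_eq_zero_add, ← tsum_mul_left]
  simp only [pow_zero, sub_self, zero_add]
  refine tsum_congr fun k => ?_
  have h3 : qPoch p p k ≠ 0 := qPoch_ne_zero (one_sub_mul_pow_ne_zero hp hp) k
  have h4 := one_sub_mul_pow_ne_zero hp hp k
  rw [qPoch_succ]
  field_simp
  ring

/-- Iterating the functional equation moves `(u; p)_n` onto the series, whose argument becomes `u
p^n → 0`. Dominated convergence leaves only the constant term. -/
theorem qPochInf_mul_eulerSeries {p u : ℂ} (hp : ‖p‖ < 1) (hu : ‖u‖ < 1) :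
    qPochInf u p * ∑' k : ℕ, (qPoch p p k)⁻¹ * u ^ k = 1 := by
  have hlt : ∀ n : ℕ, ‖u * p ^ n‖ < 1 := fun n => by
    have h2 : ‖p‖ ^ n ≤ 1 := pow_le_one₀ (norm_nonneg _) hp.le
    rw [norm_mul, norm_pow]; nlinarith [norm_nonneg u, norm_nonneg p]
  have hfin : ∀ n : ℕ, qPoch u p n * ∑' k : ℕ, (qPoch p p k)⁻¹ * u ^ k =
      ∑' k : ℕ, (qPoch p p k)⁻¹ * (u * p ^ n) ^ k := by
    intro n
    induction n with
    | zero => simp [qPoch_zero]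
    | succ n ih =>
      rw [qPoch_succ, mul_right_comm, ih, mul_comm, eulerSeries_mul hp (hlt n)]
      simp only [pow_succ, mul_assoc]
  have hlim : Tendsto (fun n : ℕ => ∑' k : ℕ, (qPoch p p k)⁻¹ * (u * p ^ n) ^ k) atTop
      (𝓝 (∑' k : ℕ, (qPoch p p k)⁻¹ * (0 : ℂ) ^ k)) := by
    refine tendsto_tsum_of_dominated_convergence (summable_eulerSeries hp hu).norm
      (fun k => ?_) (Eventually.of_forall fun n k => ?_)
    · refine Tendsto.const_mul _ (Tendsto.pow ?_ k)
      simpa using (tendsto_pow_atTop_nhds_zero_of_norm_lt_one hp).const_mul u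
    · rw [norm_mul, norm_mul, norm_pow, norm_pow, norm_mul, norm_pow]
      have h2 : ‖p‖ ^ n ≤ 1 := pow_le_one₀ (norm_nonneg _) hp.le
      gcongr
      exact mul_le_of_le_one_right (norm_nonneg _) h2
  have h0 : ∑' k : ℕ, (qPoch p p k)⁻¹ * (0 : ℂ) ^ k = 1 := by
    rw [tsum_eq_single 0 (fun k hk => by simp [hk])]
    simp [qPoch_zero]
  rw [h0] at hlim
  refine tendsto_nhds_unique ?_ hlim
  simp_rw [← hfin]
  exact (tendsto_qPoch u hp).mul_const _

/-! ### `q`-difference equations of formal power series. -/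

section PowerSeriesIdentities

open PowerSeries

/-- A `q`-difference equation for a formal power series `B` becomes a first order recurrence for
the coefficients of its product with Euler's series in base `q²`. -/
theorem euler_cauchyProduct_recurrence {q : ℂ} (hq0 : q ≠ 0) (hq : ‖q‖ < 1) (c W : ℂ) (B : ℕ → ℂ)
    (hB0 : (1 - q * c ^ 2) * (1 - q ^ 2) * B 1 = q * c * (W + c * (1 + q)) * B 0)
    (hB : ∀ j : ℕ, (1 - q * c ^ 2 * (q ^ 2) ^ (j + 1)) * (1 - (q ^ 2) ^ (j + 2)) * B (j + 2) =
      q * c * (q ^ 2) ^ (j + 1) * (W + c * (1 + q) * (q ^ 2) ^ (j + 1)) * B (j + 1) -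
        c ^ 2 * ((q ^ 2) ^ (j + 1)) ^ 2 * B j) (n : ℕ) :
    (1 - q * c ^ 2 * (q ^ 2) ^ n) * (1 - (q ^ 2) ^ (n + 1)) *
        (∑ kl ∈ Finset.HasAntidiagonal.antidiagonal (n + 1), (qPoch (q ^ 2) (q ^ 2) kl.1)⁻¹ * B kl.2) =
      (1 + q * c * W * (q ^ 2) ^ n + q ^ 2 * c ^ 2 * ((q ^ 2) ^ n) ^ 2) *
        ∑ kl ∈ Finset.HasAntidiagonal.antidiagonal n, (qPoch (q ^ 2) (q ^ 2) kl.1)⁻¹ * B kl.2 := by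
  have hp : ‖q ^ 2‖ < 1 := by
    rw [norm_pow]; exact pow_lt_one₀ (norm_nonneg _) hq two_ne_zero
  set e : ℂ⟦X⟧ := PowerSeries.mk fun k => (qPoch (q ^ 2) (q ^ 2) k)⁻¹ with he
  set b : ℂ⟦X⟧ := PowerSeries.mk B with hb
  set η : ℂ⟦X⟧ →+* ℂ⟦X⟧ := rescale (q ^ 2) with hη
  have hηX : η X = C (q ^ 2) * X := by rw [hη, rescale_X]
  have he1 : η e = (1 - X) * e := by
    ext k
    rw [sub_mul, one_mul, map_sub]
    cases k with
    | zero => simp [hη, he, coeff_rescale]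
    | succ k =>
      have h3 : qPoch (q ^ 2) (q ^ 2) k ≠ 0 := qPoch_ne_zero (one_sub_mul_pow_ne_zero hp hp) k
      have h4 := one_sub_mul_pow_ne_zero hp hp k
      simp only [hη, he, coeff_rescale, coeff_mk, coeff_succ_X_mul]
      rw [qPoch_succ]
      field_simp
      ring
  -- The recurrence as a `q`-difference equation. The terms in `η (η b)` have total coefficient `c²
  -- (1 - q² X)(1 - q³ X)`.
  have hfun : C q * b - C q * η b - C (c ^ 2) * η b + C (c ^ 2) * η (η b) =
      X * (C (q ^ 2 * c * W) * η b) + X * (C (q ^ 2 * c ^ 2 * (1 + q)) * η (η b)) -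
        X * (X * (C (q ^ 5 * c ^ 2) * η (η b))) := by
    ext k
    rcases k with _ | _ | k
    · simp only [hη, hb, map_add, map_sub, coeff_C_mul, coeff_rescale, coeff_mk, coeff_zero_X_mul]
      ring
    · simp only [hη, hb, map_add, map_sub, coeff_C_mul, coeff_rescale, coeff_mk, coeff_succ_X_mul,
        coeff_zero_X_mul, zero_add]
      linear_combination q * hB0
    · simp only [hη, hb, map_add, map_sub, coeff_C_mul, coeff_rescale, coeff_mk, coeff_succ_X_mul]
      linear_combination q * hB k
  -- Since `η (η e) = (1 - q² X)(1 - X) e`, multiplying `hfun` by this factor makes `1 - q² X`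
  -- common to all terms. Cancelling it leaves degree one in `X`, hence a first order recurrence.
  have hD : (1 - X) * (C q * (e * b)) - C q * η (e * b) - C (c ^ 2) * η (e * b) +
      C (c ^ 2) * (1 - C (q ^ 3) * X) * η (η (e * b)) = X * (C (q ^ 2 * c * W) * η (e * b)) := by
    have hne : (1 - C (q ^ 2) * X : ℂ⟦X⟧) ≠ 0 := fun h => by
      simpa using congrArg (coeff 0) h
    refine mul_left_cancel₀ hne ?_
    simp only [map_mul, map_sub, map_one, he1, hηX]
    simp only [map_mul, map_add, map_pow, map_one] at hfun ⊢
    linear_combination (1 - C q ^ 2 * X) * (1 - X) * e * hfun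
  have hcoe : ∀ m, coeff m (e * b) =
      ∑ kl ∈ Finset.HasAntidiagonal.antidiagonal m, (qPoch (q ^ 2) (q ^ 2) kl.1)⁻¹ * B kl.2 := fun m => by
    simp [coeff_mul, he, hb]
  rw [← hcoe, ← hcoe]
  have hn := congrArg (coeff (n + 1)) hD
  simp only [sub_mul, mul_sub, one_mul, mul_one, mul_assoc, map_sub, map_add, coeff_C_mul,
    coeff_succ_X_mul, hη, coeff_rescale] at hn
  refine mul_left_cancel₀ hq0 ?_
  linear_combination hn

/-- The three term recurrence of the continuous `q`-ultraspherical polynomials. -/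
theorem qUltraspherical_recurrence {q : ℂ} (hq : ‖q‖ < 1) (β θ : ℂ) (m : ℕ) :
    (1 - q ^ (m + 2)) * qUltraspherical q β (m + 2) θ =
      2 * Complex.cos θ * (1 - β * q ^ (m + 1)) * qUltraspherical q β (m + 1) θ -
        (1 - β ^ 2 * q ^ m) * qUltraspherical q β m θ := by
  set z := Complex.exp (Complex.I * θ) with hz
  have hz0 : z ≠ 0 := Complex.exp_ne_zero _
  have hcos : 2 * Complex.cos θ = z + z⁻¹ := by
    rw [Complex.two_cos, hz, ← Complex.exp_neg]
    ring_nf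
  set f : ℂ⟦X⟧ := PowerSeries.mk fun k => qPoch β q k / qPoch q q k with hf
  -- The `q`-difference equation behind the `q`-binomial theorem; `f` stands for `(βX; q)_∞ / (X;
  -- q)_∞`.
  have hf1 : (1 - X) * f = (1 - C β * X) * rescale q f := by
    ext k
    rw [sub_mul, one_mul, sub_mul, one_mul, mul_assoc, map_sub, map_sub, coeff_C_mul]
    cases k with
    | zero => simp [hf, coeff_rescale]
    | succ k =>
      have h4 := one_sub_mul_pow_ne_zero hq hq k
      simp only [hf, coeff_rescale, coeff_mk, coeff_succ_X_mul]
      rw [qPoch_succ, qPoch_succ, pow_succ']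
      simp only [div_eq_mul_inv, mul_inv]
      linear_combination
        qPoch β q k * (qPoch q q k)⁻¹ * (1 - β * q ^ k) * mul_inv_cancel₀ h4
  have hscale : ∀ a : ℂ, (1 - C a * X) * rescale a f =
      (1 - C (β * a) * X) * rescale q (rescale a f) := fun a => by
    have := congrArg (rescale a) hf1
    rw [map_mul, map_mul, map_sub, map_sub, map_one, map_mul, rescale_X, rescale_rescale,
      mul_comm q a, ← rescale_rescale] at this
    rw [this, map_mul C]
    have hC : rescale a (C β) = C β := by
      ext k
      cases k <;> simp [coeff_rescale, coeff_C]
    rw [hC, mul_assoc]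
  set F : ℂ⟦X⟧ := rescale z⁻¹ f * rescale z f with hF
  have hcoe : ∀ m, coeff m F = qUltraspherical q β m θ := fun m => by
    rw [hF, coeff_mul, Finset.Nat.sum_antidiagonal_eq_sum_range_succ_mk, qUltraspherical]
    refine Finset.sum_congr rfl fun k hk => ?_
    have hk' : k ≤ m := Nat.lt_succ_iff.mp (Finset.mem_range.mp hk)
    have hexp : Complex.exp (Complex.I * ((m : ℂ) - 2 * (k : ℂ)) * θ) = z⁻¹ ^ k * z ^ (m - k) := by
      rw [hz, ← Complex.exp_neg, ← Complex.exp_nat_mul, ← Complex.exp_nat_mul, ← Complex.exp_add,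
        Nat.cast_sub hk']
      ring_nf
    simp only [hf, coeff_rescale, coeff_mk]
    rw [hexp]
    ring
  -- With `F(X) = f(zX) f(X/z)`, the product of the equations at `z` and `z⁻¹`. The coefficient of
  -- `X^{m+2}` is the recurrence.
  have hFun : (1 - C (z + z⁻¹) * X + X * X) * F =
      (1 - C (β * (z + z⁻¹)) * X + C (β ^ 2) * (X * X)) * rescale q F := by
    have h1 := hscale z
    have h2 := hscale z⁻¹
    have h3 : (C z * C z⁻¹ : ℂ⟦X⟧) = 1 := by rw [← map_mul, mul_inv_cancel₀ hz0, map_one]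
    have h4 := congrArg₂ (· * ·) h1 h2
    simp only [map_mul, map_add, map_pow, hF] at h4 ⊢
    linear_combination h4 + (X * X * C β ^ 2 * (rescale q (rescale z f)) *
      (rescale q (rescale z⁻¹ f)) - X * X * (rescale z f) * rescale z⁻¹ f) * h3
  have hn := congrArg (coeff (m + 2)) hFun
  simp only [sub_mul, add_mul, one_mul, mul_assoc, map_sub, map_add, coeff_C_mul,
    coeff_succ_X_mul, coeff_rescale, hcoe] at hn
  rw [hcos]
  linear_combination hn

end PowerSeriesIdentities

/-! ### Connection from `q`-ultraspherical to `q`-Hermite polynomials. -/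

/-- `C_m(cos θ; β | q) / (β; q)_m`, extended by zero to negative `m`. -/
noncomputable def scaledUltraspherical (q β θ : ℂ) (m : ℤ) : ℂ :=
  if 0 ≤ m then qUltraspherical q β m.toNat θ / qPoch β q m.toNat else 0

theorem scaledUltraspherical_natCast (q β θ : ℂ) (m : ℕ) :
    scaledUltraspherical q β θ m = qUltraspherical q β m θ / qPoch β q m := by
  simp [scaledUltraspherical]

theorem scaledUltraspherical_of_neg (q β θ : ℂ) {m : ℤ} (hm : m < 0) :
    scaledUltraspherical q β θ m = 0 := by
  simp [scaledUltraspherical, hm]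

theorem qUltraspherical_zero (q β θ : ℂ) : qUltraspherical q β 0 θ = 1 := by
  simp [qUltraspherical, qPoch_zero]

theorem qUltraspherical_one (q β θ : ℂ) :
    qUltraspherical q β 1 θ = (1 - β) / (1 - q) * (2 * Complex.cos θ) := by
  rw [Complex.two_cos]
  simp [qUltraspherical, Finset.sum_range_succ, qPoch]
  ring_nf

/-- Extension by zero makes the recurrence hold for every integer index, so that later sums need no
boundary terms. -/
theorem scaledUltraspherical_recurrence {q β : ℂ} (hq : ‖q‖ < 1)
    (hβ : ∀ k : ℕ, 1 - β * q ^ k ≠ 0) (θ : ℂ) (m : ℤ) :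
    2 * Complex.cos θ * scaledUltraspherical q β θ m =
      (1 - q ^ (m + 1)) * scaledUltraspherical q β θ (m + 1) +
        (1 - β ^ 2 * q ^ (m - 1)) / ((1 - β * q ^ m) * (1 - β * q ^ (m - 1))) *
          scaledUltraspherical q β θ (m - 1) := by
  rcases lt_or_ge m (-1) with hm | hm
  · simp [scaledUltraspherical_of_neg q β θ (show m < 0 by omega),
      scaledUltraspherical_of_neg q β θ (show m + 1 < 0 by omega),
      scaledUltraspherical_of_neg q β θ (show m - 1 < 0 by omega)]
  obtain ⟨k, hk⟩ := Int.eq_ofNat_of_zero_le (show 0 ≤ m + 1 by omega)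
  rcases k with _ | _ | k
  -- The only negative index with a nonzero neighbour; there `1 - q^{m+1}` vanishes.
  · obtain rfl : m = -1 := by omega
    simp [scaledUltraspherical_of_neg]
  · obtain rfl : m = 0 := by omega
    have h0 := scaledUltraspherical_natCast q β θ 0
    have h1 := scaledUltraspherical_natCast q β θ 1
    have hb : 1 - β ≠ 0 := by simpa using hβ 0
    have hq1 : 1 - q ≠ 0 := by simpa using one_sub_pow_succ_ne_zero hq 0
    rw [qUltraspherical_zero, qPoch_zero] at h0
    rw [qUltraspherical_one, qPoch_succ, qPoch_zero] at h1
    rw [scaledUltraspherical_of_neg q β θ (show (0 : ℤ) - 1 < 0 by omega)]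
    simp only [Nat.cast_zero, Nat.cast_one] at h0 h1
    rw [zero_add, h0, h1]
    simp only [pow_zero, mul_one, one_mul, zpow_one]
    field_simp
    ring
  · obtain rfl : m = ((k + 1 : ℕ) : ℤ) := by push_cast at hk ⊢; omega
    have e1 : ((k + 1 : ℕ) : ℤ) + 1 = ((k + 2 : ℕ) : ℤ) := by push_cast; ring
    have e2 : ((k + 1 : ℕ) : ℤ) - 1 = (k : ℤ) := by push_cast; ring
    rw [e1, e2]
    simp only [scaledUltraspherical_natCast, zpow_natCast]
    have h := qUltraspherical_recurrence hq β θ k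
    have h3 : qPoch β q k ≠ 0 := qPoch_ne_zero hβ k
    have h4 := hβ k
    have h5 := hβ (k + 1)
    rw [qPoch_succ β q (k + 1), qPoch_succ β q k]
    generalize q ^ (k + 1) = s at *
    generalize q ^ k = t at *
    generalize q ^ (k + 2) = u at *
    field_simp
    linear_combination -h

/-- The connection coefficient `β^n / ((q; q)_n (β q^{N-2n+1}; q)_n)`. -/
noncomputable def connCoeff (q β : ℂ) (N : ℤ) (n : ℕ) : ℂ :=
  β ^ n / (qPoch q q n * qPoch (β * q ^ (N - 2 * n + 1)) q n)

/-- This compares the coefficients of the scaled `C_{N-1-2n}` on the two sides of the Hermite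
recurrence. -/
theorem connCoeff_recurrence {q β : ℂ} (hq : ‖q‖ < 1)
    (hβ : ∀ k : ℕ, 1 - β * q ^ k ≠ 0) {N : ℤ} {n : ℕ} (hN : 0 ≤ N - 1 - 2 * n) :
    connCoeff q β N (n + 1) * (1 - q ^ (N - 1 - 2 * n)) +
        connCoeff q β N n * ((1 - β ^ 2 * q ^ (N - 1 - 2 * n)) /
          ((1 - β * q ^ (N - 2 * n)) * (1 - β * q ^ (N - 1 - 2 * n)))) =
      (1 - q ^ (N + 1)) * connCoeff q β (N + 1) (n + 1) + connCoeff q β (N - 1) n := by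
  obtain ⟨k, hk⟩ := Int.eq_ofNat_of_zero_le hN
  obtain rfl : N = k + 1 + 2 * n := by omega
  have hz : ∀ (a : ℤ) (b : ℕ), a = b → q ^ a = q ^ b := fun a b h => by rw [h, zpow_natCast]
  simp only [connCoeff]
  rw [hz _ k (by push_cast; ring), hz _ k (by ring),
    hz _ (k + 2) (by push_cast; ring), hz _ (k + 1) (by push_cast; ring),
    hz _ (k + 2 * n + 2) (by push_cast; ring), hz _ (k + 1) (by push_cast; ring),
    hz _ (k + 1) (by push_cast; ring)]
  -- All shifted factorials in `β` are expressed through `(β q^{k+2}; q)_n`, which reduces the claim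
  -- to a rational identity.
  have e1 : qPoch (β * q ^ k) q (n + 1) =
      (1 - β * q ^ k) * ((1 - β * q ^ (k + 1)) * qPoch (β * q ^ (k + 2)) q n) /
        (1 - β * q ^ (k + n + 1)) := by
    rw [eq_div_iff (hβ _)]
    have h1 := qPoch_succ (β * q ^ k) q (n + 1)
    rw [qPoch_succ', qPoch_succ', mul_assoc β, ← pow_succ, mul_assoc β, ← pow_succ] at h1
    linear_combination -h1
  have e2 : qPoch (β * q ^ (k + 1)) q n =
      (1 - β * q ^ (k + 1)) * qPoch (β * q ^ (k + 2)) q n / (1 - β * q ^ (k + n + 1)) := by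
    rw [eq_div_iff (hβ _)]
    have h1 := qPoch_succ (β * q ^ (k + 1)) q n
    rw [qPoch_succ', mul_assoc β, ← pow_succ] at h1
    linear_combination -h1
  have e3 : qPoch (β * q ^ (k + 1)) q (n + 1) =
      (1 - β * q ^ (k + 1)) * qPoch (β * q ^ (k + 2)) q n := by
    rw [qPoch_succ']; ring_nf
  rw [e1, e2, e3, qPoch_succ]
  have hP : qPoch (β * q ^ (k + 2)) q n ≠ 0 :=
    qPoch_ne_zero (fun j => by simpa [pow_add, mul_assoc] using hβ (k + 2 + j)) n
  have hQ : qPoch q q n ≠ 0 := qPoch_ne_zero (one_sub_mul_pow_ne_zero hq hq) n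
  have h1 := one_sub_mul_pow_ne_zero hq hq n
  have h2 := hβ k
  have h3 := hβ (k + 1)
  have h4 := hβ (k + n + 1)
  have p1 : q ^ (k + 2 * n + 2) = q ^ k * (q * q ^ n) ^ 2 := by ring
  have p2 : q ^ (k + n + 1) = q ^ k * (q * q ^ n) := by ring
  rw [p2] at *
  rw [p1]
  generalize q * q ^ n = s at *
  generalize q ^ (k + 1) = r at *
  generalize q ^ k = t at *
  generalize qPoch (β * q ^ (k + 2)) q n = P at *
  generalize qPoch q q n = Q at *
  field_simp
  ring

/-- The finite sum `∑_n β^n / ((q; q)_n (β q^{N-2n+1}; q)_n) · C_{N-2n}(cos θ; β | q) / (β; q)_{N-2n}`,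
which is the continuous `q`-Hermite polynomial `H_N(cos θ | q)` divided by `(q; q)_N`. -/
noncomputable def connSum (q β θ : ℂ) (N : ℤ) : ℂ :=
  ∑' n : ℕ, connCoeff q β N n * scaledUltraspherical q β θ (N - 2 * n)

theorem summable_mul_scaledUltraspherical (q β θ : ℂ) (N : ℤ) (f : ℕ → ℂ) :
    Summable fun n : ℕ => f n * scaledUltraspherical q β θ (N - 2 * n) := by
  refine summable_of_ne_finset_zero (s := Finset.range (N.toNat + 1)) fun n hn => ?_
  rw [scaledUltraspherical_of_neg, mul_zero]
  have : N.toNat + 1 ≤ n := by simpa using hn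
  omega

theorem connSum_of_neg (q β θ : ℂ) {N : ℤ} (hN : N < 0) : connSum q β θ N = 0 := by
  refine (tsum_congr fun n => ?_).trans tsum_zero
  rw [scaledUltraspherical_of_neg _ _ _ (by omega), mul_zero]

theorem connSum_zero (q β θ : ℂ) : connSum q β θ 0 = 1 := by
  rw [connSum, tsum_eq_single 0]
  · have := scaledUltraspherical_natCast q β θ 0
    simp only [Nat.cast_zero] at this
    simp [connCoeff, qPoch_zero, this, qUltraspherical_zero]
  · intro n hn
    rw [scaledUltraspherical_of_neg _ _ _ (by omega), mul_zero]

/-- The three term recurrence of the normalized continuous `q`-Hermite polynomials. -/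
theorem connSum_recurrence {q β : ℂ} (hq : ‖q‖ < 1)
    (hβ : ∀ k : ℕ, 1 - β * q ^ k ≠ 0) (θ : ℂ) (N : ℤ) :
    2 * Complex.cos θ * connSum q β θ N =
      (1 - q ^ (N + 1)) * connSum q β θ (N + 1) + connSum q β θ (N - 1) := by
  have hS := summable_mul_scaledUltraspherical q β θ
  have e1 : ∀ n : ℕ, N + 1 - 2 * ((n + 1 : ℕ) : ℤ) = N - 1 - 2 * n := fun n => by
    push_cast; ring
  have hs1 := hS (N + 1) fun n => connCoeff q β N n * (1 - q ^ (N - 2 * n + 1))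
  have hs2 := hS (N - 1) fun n => connCoeff q β N n * ((1 - β ^ 2 * q ^ (N - 1 - 2 * n)) /
          ((1 - β * q ^ (N - 2 * n)) * (1 - β * q ^ (N - 1 - 2 * n))))
  have h1 : 2 * Complex.cos θ * connSum q β θ N =
      ∑' n : ℕ, connCoeff q β N n * (1 - q ^ (N - 2 * n + 1)) *
          scaledUltraspherical q β θ (N + 1 - 2 * n) +
        ∑' n : ℕ, connCoeff q β N n * ((1 - β ^ 2 * q ^ (N - 1 - 2 * n)) /
          ((1 - β * q ^ (N - 2 * n)) * (1 - β * q ^ (N - 1 - 2 * n)))) *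
          scaledUltraspherical q β θ (N - 1 - 2 * n) := by
    rw [← hs1.tsum_add hs2, connSum, ← tsum_mul_left]
    refine tsum_congr fun n => ?_
    have h := scaledUltraspherical_recurrence hq hβ θ (N - 2 * n)
    rw [show N - 2 * (n : ℤ) - 1 = N - 1 - 2 * n by ring,
      show N + 1 - 2 * (n : ℤ) = N - 2 * n + 1 by ring]
      at *
    linear_combination connCoeff q β N n * h
  have hs3 := hS (N + 1) fun n => (1 - q ^ (N + 1)) * connCoeff q β (N + 1) n
  have hs4 := hS (N - 1) fun n => connCoeff q β (N - 1) n
  have hs1' := (summable_nat_add_iff 1).mpr hs1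
  have hs3' := (summable_nat_add_iff 1).mpr hs3
  have h2 : (1 - q ^ (N + 1)) * connSum q β θ (N + 1) =
      ∑' n : ℕ, (1 - q ^ (N + 1)) * connCoeff q β (N + 1) n *
        scaledUltraspherical q β θ (N + 1 - 2 * n) := by
    rw [connSum, ← tsum_mul_left]
    simp only [mul_assoc]
  -- Splitting off `n = 0` shifts the series in `C_{N+1-2n}` by one, to align it with that in
  -- `C_{N-1-2n}`.
  rw [h1, h2, hs1.tsum_eq_zero_add, hs3.tsum_eq_zero_add, connSum, add_assoc, add_assoc,
    ← hs1'.tsum_add hs2, ← hs3'.tsum_add hs4]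
  congr 1
  · simp [connCoeff, qPoch_zero]
  · refine tsum_congr fun n => ?_
    rw [e1]
    rcases lt_or_ge (N - 1 - 2 * (n : ℤ)) 0 with hn | hn
    · simp [scaledUltraspherical_of_neg _ _ _ hn]
    · have h := connCoeff_recurrence hq hβ hn
      rw [show N - 2 * ((n + 1 : ℕ) : ℤ) + 1 = N - 1 - 2 * n by push_cast; ring]
      linear_combination scaledUltraspherical q β θ (N - 1 - 2 * n) * h

theorem connSum_one {q β : ℂ} (hq : ‖q‖ < 1)
    (hβ : ∀ k : ℕ, 1 - β * q ^ k ≠ 0) (θ : ℂ) :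
    connSum q β θ 1 = 2 * Complex.cos θ / (1 - q) := by
  have h := connSum_recurrence hq hβ θ 0
  have hq1 : 1 - q ≠ 0 := by simpa using one_sub_pow_succ_ne_zero hq 0
  rw [connSum_zero, connSum_of_neg _ _ _ (show (0 : ℤ) - 1 < 0 by omega)] at h
  rw [eq_div_iff hq1]
  simp only [zero_add, zpow_one] at h
  linear_combination -h

/-- Combining the recurrences at `N - 1`, `N` and `N + 1` eliminates the neighbours of opposite
parity. -/
theorem connSum_two_step {q β : ℂ} (hq : ‖q‖ < 1)
    (hβ : ∀ k : ℕ, 1 - β * q ^ k ≠ 0) (θ : ℂ) (N : ℤ) :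
    (1 - q ^ (N + 1)) * (1 - q ^ (N + 2)) * connSum q β θ (N + 2) =
      ((2 * Complex.cos θ) ^ 2 - 2 + q ^ N + q ^ (N + 1)) * connSum q β θ N -
        connSum q β θ (N - 2) := by
  have h0 := connSum_recurrence hq hβ θ N
  have h1 := connSum_recurrence hq hβ θ (N + 1)
  have h2 := connSum_recurrence hq hβ θ (N - 1)
  rw [show N + 1 + 1 = N + 2 by ring, show N + 1 - 1 = N by ring] at h1
  rw [show N - 1 + 1 = N by ring, show N - 1 - 1 = N - 2 by ring] at h2
  linear_combination -(2 * Complex.cos θ) * h0 - (1 - q ^ (N + 1)) * h1 - h2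

/-! ### Summation of the even and odd parts. -/

/-- For `W = w + w⁻¹`, the right factor of the first order recurrence is `(1 + q c w t)(1 + q c w⁻¹
t)` with `t = q^{2n}`, so iteration gives shifted factorials. -/
theorem qPochInf_mul_tsum_eq {q : ℂ} (hq0 : q ≠ 0) (hq : ‖q‖ < 1) {c w u : ℂ} (hw : w ≠ 0)
    (hu : ‖u‖ < 1) (hc : ∀ k : ℕ, 1 - q * c ^ 2 * (q ^ 2) ^ k ≠ 0) (B : ℕ → ℂ)
    (hB0 : (1 - q * c ^ 2) * (1 - q ^ 2) * B 1 = q * c * (w + w⁻¹ + c * (1 + q)) * B 0)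
    (hB : ∀ j : ℕ, (1 - q * c ^ 2 * (q ^ 2) ^ (j + 1)) * (1 - (q ^ 2) ^ (j + 2)) * B (j + 2) =
      q * c * (q ^ 2) ^ (j + 1) * (w + w⁻¹ + c * (1 + q) * (q ^ 2) ^ (j + 1)) * B (j + 1) -
        c ^ 2 * ((q ^ 2) ^ (j + 1)) ^ 2 * B j)
    (hs : Summable fun j => B j * u ^ j) :
    qPochInf u (q ^ 2) * ((∑' j : ℕ, qPoch (-(q * c * w)) (q ^ 2) j *
        qPoch (-(q * c * w⁻¹)) (q ^ 2) j /
          (qPoch (q * c ^ 2) (q ^ 2) j * qPoch (q ^ 2) (q ^ 2) j) * u ^ j) * B 0) =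
      ∑' j : ℕ, B j * u ^ j := by
  have hp : ‖q ^ 2‖ < 1 := by
    rw [norm_pow]; exact pow_lt_one₀ (norm_nonneg _) hq two_ne_zero
  have hpp := one_sub_mul_pow_ne_zero hp hp
  have hrec := euler_cauchyProduct_recurrence hq0 hq c (w + w⁻¹) B hB0 hB
  have hcoef : ∀ j : ℕ, qPoch (-(q * c * w)) (q ^ 2) j * qPoch (-(q * c * w⁻¹)) (q ^ 2) j /
      (qPoch (q * c ^ 2) (q ^ 2) j * qPoch (q ^ 2) (q ^ 2) j) * B 0 =
      ∑ kl ∈ Finset.HasAntidiagonal.antidiagonal j,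
        (qPoch (q ^ 2) (q ^ 2) kl.1)⁻¹ * B kl.2 := by
    intro j
    induction j with
    | zero => simp [qPoch_zero]
    | succ j ih =>
      have h1 := hc j
      have h2 := hpp j
      have h5 := qPoch_ne_zero hc j
      have h6 := qPoch_ne_zero hpp j
      have h3 := hrec j
      rw [← ih] at h3
      have h4 : (1 - q * c ^ 2 * (q ^ 2) ^ j) * (1 - (q ^ 2) ^ (j + 1)) ≠ 0 :=
        mul_ne_zero h1 (by rw [pow_succ']; exact h2)
      refine mul_left_cancel₀ h4 ?_
      rw [h3]
      simp only [qPoch_succ]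
      rw [pow_succ' (q ^ 2) j]
      generalize (q ^ 2) ^ j = t at *
      field_simp
      ring
  have hprod := tsum_mul_tsum_eq_tsum_sum_antidiagonal_of_summable_norm
    (summable_eulerSeries hp hu).norm hs.norm
  have hterm : ∀ j : ℕ, ∑ kl ∈ Finset.HasAntidiagonal.antidiagonal j,
      (qPoch (q ^ 2) (q ^ 2) kl.1)⁻¹ * u ^ kl.1 * (B kl.2 * u ^ kl.2) =
      (qPoch (-(q * c * w)) (q ^ 2) j * qPoch (-(q * c * w⁻¹)) (q ^ 2) j /
      (qPoch (q * c ^ 2) (q ^ 2) j * qPoch (q ^ 2) (q ^ 2) j) * u ^ j) * B 0 := by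
    intro j
    rw [mul_right_comm, hcoef, Finset.sum_mul]
    refine Finset.sum_congr rfl fun kl hkl => ?_
    rw [← Finset.HasAntidiagonal.mem_antidiagonal.mp hkl, pow_add]
    ring
  rw [← tsum_mul_right, ← tsum_congr hterm, ← hprod, ← mul_assoc,
    qPochInf_mul_eulerSeries hp hu, one_mul]

/-! ### Estimates and rearrangement of the double series. -/

theorem summable_pow_sq_mul_pow {r : ℝ} (hr0 : 0 ≤ r) (hr1 : r < 1) {y : ℝ} (hy : 0 ≤ y) :
    Summable fun m : ℕ => r ^ (m ^ 2) * y ^ m := by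
  have hlim : Tendsto (fun m : ℕ => r ^ m * y) atTop (𝓝 0) := by
    simpa using (tendsto_pow_atTop_nhds_zero_of_lt_one hr0 hr1).mul_const y
  refine Summable.of_norm_bounded_eventually_nat summable_geometric_two ?_
  filter_upwards [hlim.eventually_le_const (show (0 : ℝ) < 1 / 2 by norm_num)] with m hm
  rw [Real.norm_of_nonneg (by positivity), sq, pow_mul, ← mul_pow]
  exact pow_le_pow_left₀ (by positivity) hm m

theorem exists_norm_qUltraspherical_le {q : ℂ} (hq : ‖q‖ < 1) (β θ : ℂ) :
    ∃ K Y : ℝ, 0 < K ∧ 0 < Y ∧ ∀ m, ‖qUltraspherical q β m θ‖ ≤ K * Y ^ m := by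
  obtain ⟨M, hM0, hM⟩ := exists_norm_qPoch_le β hq
  obtain ⟨M', hM0', hM'⟩ := exists_norm_qPoch_inv_le hq (one_sub_mul_pow_ne_zero hq hq)
  refine ⟨(M * M') ^ 2, 2 * Real.exp |θ.im|, by positivity, by positivity, fun m => ?_⟩
  have hterm : ∀ k ∈ Finset.range (m + 1), ‖qPoch β q k * qPoch β q (m - k) /
      (qPoch q q k * qPoch q q (m - k)) * Complex.exp (Complex.I * ((m : ℂ) - 2 * (k : ℂ)) * θ)‖ ≤
      (M * M') ^ 2 * Real.exp |θ.im| ^ m := by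
    intro k hk
    have hk' : (k : ℝ) ≤ m := by
      exact_mod_cast Nat.lt_succ_iff.mp (Finset.mem_range.mp hk)
    have hexp : ‖Complex.exp (Complex.I * ((m : ℂ) - 2 * (k : ℂ)) * θ)‖ ≤
        Real.exp |θ.im| ^ m := by
      rw [Complex.norm_exp, ← Real.exp_nat_mul]
      refine Real.exp_le_exp.mpr ?_
      have : (Complex.I * ((m : ℂ) - 2 * (k : ℂ)) * θ).re = -((m - 2 * k : ℝ) * θ.im) := by
        simp [Complex.mul_re, Complex.mul_im]
      rw [this]
      refine (neg_le_abs _).trans ?_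
      rw [abs_mul]
      refine mul_le_mul_of_nonneg_right (abs_le.mpr ⟨?_, ?_⟩) (abs_nonneg _)
      · linarith
      · have : (0 : ℝ) ≤ k := Nat.cast_nonneg k
        linarith
    rw [norm_mul, div_eq_mul_inv, mul_inv, norm_mul, norm_mul, norm_mul]
    refine mul_le_mul ?_ hexp (norm_nonneg _) (by positivity)
    calc _ ≤ (M * M) * (M' * M') := by
            gcongr
            exacts [hM _, hM _, hM' _, hM' _]
      _ = _ := by ring
  refine (norm_sum_le_of_le _ hterm).trans ?_
  rw [Finset.sum_const, Finset.card_range, nsmul_eq_mul, mul_pow 2]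
  have h2 : ((m + 1 : ℕ) : ℝ) ≤ 2 ^ m := by exact_mod_cast Nat.lt_two_pow_self
  calc _ ≤ 2 ^ m * ((M * M') ^ 2 * Real.exp |θ.im| ^ m) :=
        mul_le_mul_of_nonneg_right h2 (by positivity)
    _ = _ := by ring

/-- The doubly indexed summand, arranged by total degree `N` in `ω`. -/
noncomputable def doubleTerm (s β θ ω : ℂ) (x : ℕ × ℕ) : ℂ :=
  Complex.I ^ x.1 * s ^ (x.1 ^ 2) * ω ^ x.1 *
    (connCoeff (s ^ 4) β x.1 x.2 * scaledUltraspherical (s ^ 4) β θ ((x.1 : ℤ) - 2 * x.2))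

theorem doubleTerm_add (s β θ ω : ℂ) (m n : ℕ) :
    doubleTerm s β θ ω (m + 2 * n, n) =
      Complex.I ^ m * (-1) ^ n * s ^ (m ^ 2) * (s ^ 4) ^ (m * n) * (s ^ 4) ^ (n ^ 2) *
        ω ^ (m + 2 * n) * β ^ n * (qPoch (s ^ 4) (s ^ 4) n)⁻¹ *
        (qPoch β (s ^ 4) m * qPoch (β * (s ^ 4) ^ (m + 1)) (s ^ 4) n)⁻¹ *
        qUltraspherical (s ^ 4) β m θ := by
  have e1 : (((m + 2 * n : ℕ) : ℤ) - 2 * n) = m := by push_cast; ring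
  have e2 : (s ^ 4) ^ ((m : ℤ) + 1) = (s ^ 4) ^ (m + 1) := by
    rw [← zpow_natCast]; norm_cast
  simp only [doubleTerm, connCoeff]
  rw [e1, e2, scaledUltraspherical_natCast, pow_add, pow_mul, Complex.I_sq,
    show s ^ ((m + 2 * n) ^ 2) = s ^ (m ^ 2) * (s ^ 4) ^ (m * n) * (s ^ 4) ^ (n ^ 2) by ring]
  simp only [div_eq_mul_inv, mul_inv]
  ring

theorem injective_addTwoMul : Function.Injective fun x : ℕ × ℕ => (x.1 + 2 * x.2, x.2) := by
  rintro ⟨a, b⟩ ⟨c, d⟩ h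
  simp only [Prod.mk.injEq] at h ⊢
  omega

theorem doubleTerm_eq_zero (s β θ ω : ℂ) (x : ℕ × ℕ)
    (hx : x ∉ Set.range fun x : ℕ × ℕ => (x.1 + 2 * x.2, x.2)) : doubleTerm s β θ ω x = 0 := by
  have : (x.1 : ℤ) - 2 * x.2 < 0 := by
    by_contra! h
    exact hx ⟨(x.1 - 2 * x.2, x.2), Prod.ext (by simp only; omega) rfl⟩
  rw [doubleTerm, scaledUltraspherical_of_neg _ _ _ this, mul_zero, mul_zero]

theorem summable_doubleTerm_add {s β ω : ℂ} (θ : ℂ) (hs : ‖s‖ < 1)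
    (hβ : ∀ k : ℕ, 1 - β * (s ^ 4) ^ k ≠ 0) (hω : ‖ω‖ < 1) :
    Summable fun x : ℕ × ℕ => doubleTerm s β θ ω (x.1 + 2 * x.2, x.2) := by
  have hq : ‖s ^ 4‖ < 1 := by
    rw [norm_pow]; exact pow_lt_one₀ (norm_nonneg _) hs four_ne_zero
  obtain ⟨K, Y, hK, hY, hC⟩ := exists_norm_qUltraspherical_le hq β θ
  obtain ⟨M, hM0, hM⟩ := exists_norm_qPoch_inv_le hq (one_sub_mul_pow_ne_zero hq hq)
  obtain ⟨M', hM0', hM'⟩ := exists_norm_qPoch_inv_le hq hβ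
  have hsum := (((summable_pow_sq_mul_pow (norm_nonneg s) hs hY.le).mul_of_nonneg
    (summable_pow_sq_mul_pow (norm_nonneg (s ^ 4)) hq (norm_nonneg β))
    (fun _ => by positivity) (fun _ => by positivity)).mul_left (M * ((1 + ‖β‖) * M') * K))
  refine Summable.of_norm_bounded hsum fun ⟨m, n⟩ => ?_
  -- The product is `(β; q)_{m+1+n}` without its factor `1 - β q^m`, so one bound serves all `m` and
  -- `n`.
  have hden : ‖(qPoch β (s ^ 4) m * qPoch (β * (s ^ 4) ^ (m + 1)) (s ^ 4) n)⁻¹‖ ≤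
      (1 + ‖β‖) * M' := by
    have h1 : (qPoch β (s ^ 4) m * qPoch (β * (s ^ 4) ^ (m + 1)) (s ^ 4) n)⁻¹ =
        (1 - β * (s ^ 4) ^ m) * (qPoch β (s ^ 4) (m + 1 + n))⁻¹ := by
      rw [qPoch_add, qPoch_succ, mul_inv, mul_inv, mul_inv]
      have := hβ m
      generalize 1 - β * (s ^ 4) ^ m = d at *
      field_simp
    rw [h1, norm_mul]
    refine mul_le_mul ?_ (hM' _) (norm_nonneg _) (by positivity)
    refine (norm_sub_le _ _).trans ?_
    rw [norm_one, norm_mul, norm_pow]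
    gcongr
    exact mul_le_of_le_one_right (norm_nonneg _) (pow_le_one₀ (norm_nonneg _) hq.le)
  rw [doubleTerm_add]
  simp only [norm_mul, norm_pow, Complex.norm_I, norm_neg, norm_one, one_pow, one_mul]
  simp only [norm_pow] at hden hq hC hM
  calc _ ≤ ‖s‖ ^ m ^ 2 * 1 * (‖s‖ ^ 4) ^ n ^ 2 * 1 * ‖β‖ ^ n * M * ((1 + ‖β‖) * M') *
        (K * Y ^ m) := by
        gcongr
        · exact pow_le_one₀ (by positivity) hq.le
        · exact pow_le_one₀ (by positivity) hω.le
        · exact hM n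
        · exact hC m
    _ = _ := by ring

/-- Off the image of `(m, n) ↦ (m + 2n, n)` the ultraspherical index is negative and the summand
vanishes, so both orders of summation agree. -/
theorem hasSum_connSum {s β ω : ℂ} (θ : ℂ) (hs : ‖s‖ < 1)
    (hβ : ∀ k : ℕ, 1 - β * (s ^ 4) ^ k ≠ 0) (hω : ‖ω‖ < 1) :
    HasSum (fun N : ℕ => Complex.I ^ N * s ^ (N ^ 2) * ω ^ N * connSum (s ^ 4) β θ N)
      (∑' m : ℕ, ∑' n : ℕ, doubleTerm s β θ ω (m + 2 * n, n)) := by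
  have h1 := summable_doubleTerm_add θ hs hβ hω
  have h2 : Summable (doubleTerm s β θ ω) :=
    (injective_addTwoMul.summable_iff (doubleTerm_eq_zero s β θ ω)).mp h1
  have h3 : ∑' x, doubleTerm s β θ ω x =
      ∑' m : ℕ, ∑' n : ℕ, doubleTerm s β θ ω (m + 2 * n, n) := by
    rw [← h1.tsum_prod (f := fun x : ℕ × ℕ => doubleTerm s β θ ω (x.1 + 2 * x.2, x.2))]
    refine (injective_addTwoMul.tsum_eq fun x hx => ?_).symm
    by_contra h
    exact hx (doubleTerm_eq_zero s β θ ω x h)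
  rw [← h3]
  refine h2.hasSum.prod_fiberwise fun N => ?_
  simp only [doubleTerm, connSum]
  exact (summable_mul_scaledUltraspherical (s ^ 4) β θ N _).hasSum.mul_left _

/-! ### The two expansions of the basic exponential. -/

theorem two_cos_sq_sub_two (θ : ℂ) :
    (2 * Complex.cos θ) ^ 2 - 2 =
      Complex.exp (2 * Complex.I * θ) + (Complex.exp (2 * Complex.I * θ))⁻¹ := by
  have h1 : Complex.exp (2 * Complex.I * θ) = Complex.exp (θ * Complex.I) ^ 2 := by
    rw [← Complex.exp_nat_mul]; push_cast; ring_nf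
  have h2 := Complex.exp_ne_zero (θ * Complex.I)
  rw [Complex.two_cos, h1, neg_mul, Complex.exp_neg]
  field_simp
  ring

/-- The expansion of the basic exponential function in continuous `q`-Hermite polynomials. -/
theorem basicExp_eq_of_hasSum {q s β θ ω S : ℂ} (hs4 : s ^ 4 = q) (hsq : q ^ (1 / 4 : ℂ) = s)
    (hq0 : q ≠ 0) (hq : ‖q‖ < 1) (hβ : ∀ k : ℕ, 1 - β * q ^ k ≠ 0) (hω0 : ω ≠ 0) (hω : ‖ω‖ < 1)
    (hS : HasSum (fun N : ℕ => Complex.I ^ N * s ^ (N ^ 2) * ω ^ N * connSum q β θ N) S) :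
    basicExp q θ ω = S / qPochInf (-q * ω ^ 2) (q ^ 2) := by
  have hs0 : s ≠ 0 := fun h => hq0 (by rw [← hs4, h]; simp)
  have hp : ‖q ^ 2‖ < 1 := by
    rw [norm_pow]; exact pow_lt_one₀ (norm_nonneg _) hq two_ne_zero
  have hu : ‖-ω ^ 2‖ < 1 := by
    rw [norm_neg, norm_pow]; exact pow_lt_one₀ (norm_nonneg _) hω two_ne_zero
  set w := Complex.exp (2 * Complex.I * θ) with hw
  have hw0 : w ≠ 0 := Complex.exp_ne_zero _
  have hwinv : Complex.exp (-2 * Complex.I * θ) = w⁻¹ := by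
    rw [hw, ← Complex.exp_neg]; ring_nf
  have hW := two_cos_sq_sub_two θ
  rw [← hw] at hW
  have htwo := connSum_two_step hq hβ θ
  have hz : ∀ (a : ℤ) (b : ℕ), a = b → q ^ a = q ^ b := fun a b h => by rw [h, zpow_natCast]
  set F : ℕ → ℂ := fun N => Complex.I ^ N * s ^ (N ^ 2) * ω ^ N * connSum q β θ N with hF
  -- Since `s^4 = q`, `s^{(2j)²} = q^{j²}` and `s^{(2j+1)²} = s q^{j²+j}`. The two-step recurrence
  -- then has the required form with `c = 1` for even and `c = q` for odd indices.
  set B : ℕ → ℂ := fun j => q ^ (j ^ 2) * connSum q β θ (2 * j) with hB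
  set B' : ℕ → ℂ := fun j => q ^ (j ^ 2 + j) * connSum q β θ (2 * j + 1) with hB'
  have hFe : ∀ j, F (2 * j) = B j * (-ω ^ 2) ^ j := fun j => by
    simp only [hF, hB]
    rw [pow_mul Complex.I, Complex.I_sq, ← hs4]
    push_cast
    rw [neg_pow (ω ^ 2)]
    ring
  have hFo : ∀ j, F (2 * j + 1) = Complex.I * s * ω * (B' j * (-ω ^ 2) ^ j) := fun j => by
    simp only [hF, hB']
    rw [pow_succ Complex.I, pow_mul Complex.I, Complex.I_sq, ← hs4]
    push_cast
    rw [neg_pow (ω ^ 2)]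
    ring
  have hse : Summable fun j => F (2 * j) :=
    hS.summable.comp_injective (mul_right_injective₀ two_ne_zero)
  have hso : Summable fun j => F (2 * j + 1) :=
    hS.summable.comp_injective ((add_left_injective 1).comp (mul_right_injective₀ two_ne_zero))
  have hsplit := tsum_even_add_odd hse hso
  rw [hS.tsum_eq] at hsplit
  simp only [hFe, hFo] at hse hso hsplit
  rw [tsum_mul_left] at hsplit
  have hIsω : Complex.I * s * ω ≠ 0 := mul_ne_zero (mul_ne_zero Complex.I_ne_zero hs0) hω0
  have hso' := (summable_mul_left_iff hIsω).mp hso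
  have hcos := qPochInf_mul_tsum_eq hq0 hq (c := 1) hw0 hu
    (fun k => by simpa using one_sub_mul_pow_ne_zero hq hp k) B
    (by
      have h := htwo 0
      rw [hW, hz (0 + 1) 1 (by simp), hz (0 + 2) 2 (by simp),
        connSum_of_neg _ _ _ (show (0 : ℤ) - 2 < 0 by omega)] at h
      simp only [hB]
      norm_num at h ⊢
      linear_combination q * h)
    (fun j => by
      have h := htwo (2 * j + 2)
      rw [hW, hz (2 * j + 2 + 1) (2 * j + 3) (by push_cast; ring),
        hz (2 * j + 2 + 2) (2 * j + 4) (by push_cast; ring),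
        hz (2 * j + 2) (2 * j + 2) (by push_cast; ring)] at h
      simp only [hB]
      push_cast
      rw [show 2 * ((j : ℤ) + 2) = 2 * j + 2 + 2 by ring,
        show 2 * ((j : ℤ) + 1) = 2 * j + 2 by ring]
      rw [show 2 * (j : ℤ) + 2 - 2 = 2 * j by ring] at h
      linear_combination q ^ ((j + 2) ^ 2) * h)
    hse
  have hsin := qPochInf_mul_tsum_eq hq0 hq (c := q) hw0 hu
    (fun k => by
      rw [show q * q ^ 2 * (q ^ 2) ^ k = q ^ (2 * k + 2 + 1) by ring]
      exact one_sub_pow_succ_ne_zero hq _) B'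
    (by
      have h := htwo 1
      rw [hW, hz (1 + 1) 2 (by simp), hz (1 + 2) 3 (by simp),
        connSum_of_neg _ _ _ (show (1 : ℤ) - 2 < 0 by omega)] at h
      simp only [hB']
      norm_num at h ⊢
      linear_combination q ^ 2 * h)
    (fun j => by
      have h := htwo (2 * j + 3)
      rw [hW, hz (2 * j + 3 + 1) (2 * j + 4) (by push_cast; ring),
        hz (2 * j + 3 + 2) (2 * j + 5) (by push_cast; ring),
        hz (2 * j + 3) (2 * j + 3) (by push_cast; ring)] at h
      simp only [hB']
      push_cast
      rw [show 2 * ((j : ℤ) + 2) + 1 = 2 * j + 3 + 2 by ring,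
        show 2 * ((j : ℤ) + 1) + 1 = 2 * j + 3 by ring]
      rw [show 2 * (j : ℤ) + 3 - 2 = 2 * j + 1 by ring] at h
      linear_combination q ^ ((j + 2) ^ 2 + j + 2) * h)
    hso'
  have hB0 : B 0 = 1 := by simp [hB, connSum_zero]
  have hB0' : B' 0 = 2 * Complex.cos θ / (1 - q) := by simp [hB', connSum_one hq hβ]
  rw [hB0] at hcos
  rw [hB0'] at hsin
  rw [← hsplit, ← hcos, ← hsin, basicExp, basicCos, basicSin, hsq, hwinv, ← hw]
  rw [show q * q ^ 2 = q ^ 3 by ring]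
  simp only [one_pow, mul_one, neg_mul, ← sq]
  ring

/-- The `m`-th term of the Ismail–Zhang series, up to a constant factor, as an inner sum. -/
theorem mul_ismailZhangTerm {q s ν ω : ℂ} (θ : ℂ) (hs4 : s ^ 4 = q) (hsq : q ^ (1 / 4 : ℂ) = s)
    (hq0 : q ≠ 0) (hq : ‖q‖ < 1) (hβ : ∀ k : ℕ, 1 - q ^ ν * q ^ k ≠ 0) (hω0 : ω ≠ 0) (m : ℕ) :
    qPochInf q q * ω ^ (-ν) / qPochInf (q ^ ν) q * ismailZhangTerm q ν θ ω m =
      ∑' n : ℕ, doubleTerm s (q ^ ν) θ ω (m + 2 * n, n) := by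
  have hpow : ∀ k : ℕ, q ^ (ν + k) = q ^ ν * q ^ k := fun k => by
    rw [Complex.cpow_add _ _ hq0, Complex.cpow_natCast]
  have hpow1 : q ^ (ν + m + 1) = q ^ ν * q ^ (m + 1) := by
    rw [← hpow]; push_cast; ring_nf
  have hs : q ^ ((m : ℂ) ^ 2 / 4) = s ^ (m ^ 2) := by
    rw [← hsq, ← Complex.cpow_nat_mul]; push_cast; ring_nf
  have hqq := qPochInf_ne_zero hq (one_sub_mul_pow_ne_zero hq hq)
  have hβm := qPochInf_ne_zero (a := q ^ ν * q ^ (m + 1)) hq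
    fun k => by simpa [pow_add, mul_assoc] using hβ (m + 1 + k)
  -- The middle factor cancels `1 - q^{ν+m}` in the term and the last cancels the Bessel prefactor,
  -- leaving `1/(q^ν; q)_m`.
  have hfac : qPochInf (q ^ ν) q =
      qPoch (q ^ ν) q m * (1 - q ^ ν * q ^ m) * qPochInf (q ^ ν * q ^ (m + 1)) q := by
    rw [qPochInf_eq_mul _ hq (m + 1), qPoch_succ]
  have hm := qPoch_ne_zero hβ m
  have hm1 := hβ m
  have hων : ω ^ ν ≠ 0 := by simp [Complex.cpow_eq_zero_iff, hω0]
  rw [ismailZhangTerm, jacksonBessel2, hpow1, hpow, hs, hfac]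
  have hinner : ∀ n : ℕ, q ^ ((ν + m + n) * n) * ((-1) ^ n * (2 * ω / 2) ^ (ν + m + 2 * n)) /
      (qPoch q q n * qPoch (q ^ ν * q ^ (m + 1)) q n) =
      ω ^ ν * (q ^ (m * n) * q ^ (n ^ 2) * (q ^ ν) ^ n * (-1) ^ n * ω ^ (m + 2 * n) *
        (qPoch q q n)⁻¹ * (qPoch (q ^ ν * q ^ (m + 1)) q n)⁻¹) := fun n => by
    have e1 : q ^ ((ν + m + n) * n) = q ^ (m * n) * q ^ (n ^ 2) * (q ^ ν) ^ n := by
      rw [Complex.cpow_mul_nat, add_assoc, ← Nat.cast_add, hpow]; ring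
    have e2 : (2 * ω / 2) ^ (ν + m + 2 * n) = ω ^ ν * ω ^ (m + 2 * n) := by
      rw [mul_div_cancel_left₀ _ two_ne_zero, ← Complex.cpow_natCast, ← Complex.cpow_add _ _ hω0]
      push_cast; ring_nf
    rw [e1, e2, div_eq_mul_inv, mul_inv]
    ring
  rw [tsum_congr hinner, tsum_mul_left]
  have hout : ∀ n : ℕ, doubleTerm s (q ^ ν) θ ω (m + 2 * n, n) =
      Complex.I ^ m * s ^ (m ^ 2) * (qPoch (q ^ ν) q m)⁻¹ * qUltraspherical q (q ^ ν) m θ *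
      (q ^ (m * n) * q ^ (n ^ 2) * (q ^ ν) ^ n * (-1) ^ n * ω ^ (m + 2 * n) *
        (qPoch q q n)⁻¹ * (qPoch (q ^ ν * q ^ (m + 1)) q n)⁻¹) := fun n => by
    rw [doubleTerm_add, hs4, mul_inv]
    ring
  rw [tsum_congr hout, tsum_mul_left, Complex.cpow_neg]
  generalize 1 - q ^ ν * q ^ m = d at *
  field_simp

end IsmailZhang

theorem mainTheorem1 (q : ℝ) (hq0 : 0 < q) (hq1 : q < 1)
    (ν θ ω : ℂ) (hν : ∀ k : ℕ, (q : ℂ) ^ (ν + k) ≠ 1)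
    (hω0 : ω ≠ 0) (hω1 : ‖ω‖ < 1) :
    Summable (fun m : ℕ => IsmailZhang.ismailZhangTerm q ν θ ω m) ∧
    IsmailZhang.basicExp q θ ω =
      IsmailZhang.qPochInf q q * ω ^ (-ν) /
          (IsmailZhang.qPochInf ((q : ℂ) ^ ν) q *
            IsmailZhang.qPochInf (-q * ω ^ 2) ((q : ℂ) ^ 2)) *
        ∑' m : ℕ, IsmailZhang.ismailZhangTerm q ν θ ω m := by
  have hqc : (q : ℂ) ≠ 0 := Complex.ofReal_ne_zero.mpr hq0.ne'
  have hqn : ‖(q : ℂ)‖ < 1 := by rwa [Complex.norm_real, Real.norm_of_nonneg hq0.le]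
  obtain ⟨s, hs⟩ : ∃ s : ℂ, (q : ℂ) ^ (1 / 4 : ℂ) = s := ⟨_, rfl⟩
  have hs4 : s ^ 4 = q := by
    rw [← hs, ← Complex.cpow_nat_mul]; norm_num
  have hs1 : ‖s‖ < 1 := by
    by_contra! h
    refine hqn.not_ge ?_
    rw [← hs4, norm_pow]
    exact one_le_pow₀ h
  have hβ : ∀ k : ℕ, 1 - (q : ℂ) ^ ν * (q : ℂ) ^ k ≠ 0 := fun k h => hν k (by
    rw [Complex.cpow_add _ _ hqc, Complex.cpow_natCast]
    exact (sub_eq_zero.mp h).symm)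
  have hβ' : ∀ k : ℕ, 1 - (q : ℂ) ^ ν * (s ^ 4) ^ k ≠ 0 := by rwa [hs4]
  have hterm := IsmailZhang.mul_ismailZhangTerm θ hs4 hs hqc hqn hβ hω0
  have hconst : IsmailZhang.qPochInf q q * ω ^ (-ν) / IsmailZhang.qPochInf ((q : ℂ) ^ ν) q ≠ 0 := by
    refine div_ne_zero (mul_ne_zero ?_ ?_) (IsmailZhang.qPochInf_ne_zero hqn hβ)
    · exact IsmailZhang.qPochInf_ne_zero hqn (IsmailZhang.one_sub_mul_pow_ne_zero hqn hqn)
    · simp [Complex.cpow_eq_zero_iff, hω0]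
  have hsum := (IsmailZhang.summable_doubleTerm_add θ hs1 hβ' hω1).prod
  have hS := IsmailZhang.hasSum_connSum θ hs1 hβ' hω1
  simp only [← hterm] at hsum hS
  rw [tsum_mul_left, hs4] at hS
  refine ⟨(summable_mul_left_iff hconst).mp hsum, ?_⟩
  rw [IsmailZhang.basicExp_eq_of_hasSum hs4 hs hqc hqn hβ hω0 hω1 hS]
  simp only [div_eq_mul_inv, mul_inv]
  ring
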